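/- Fix $\tau\in\mathbb C$ with $\operatorname{Im}\tau>0$, let $\Lambda=\mathbb Z+\mathbb Z\tau$, $E=\mathbb C/\Lambda$, and let $$\theta_j(z)=\sum_{n\in\mathbb Z}(-1)^{n+j}\exp\!\Big(3\pi i\tau\big(n+\tfrac j3+\tfrac12\big)^2+6\pi i\big(n+\tfrac j3+\tfrac12\big)z\Big),\qquad j=0,1,2,$$ be the theta functions of order three, so that $z\mapsto[\theta_0(z):\theta_1(z):\theta_2(z)]$ embeds $E$ in $\mathbb P^2$ as a Hesse cubic. For vectors $p=(p_0,p_1,p_2)$ and $x=(x_0,x_1,x_2)$ in $\mathbb C^3$ let $$M(p,x)=\begin{pmatrix}p_0x_0&p_2x_2&p_1x_1\\p_2x_1&p_1x_0&p_0x_2\\p_1x_2&p_0x_1&p_2x_0\end{pmatrix}$$ be the Moore matrix. For $a\in\mathbb C$ put $\theta(a)=(\theta_0(a),\theta_1(a),\theta_2(a))$, $M_{a,x}=M(\theta(a),x)$ and $M'_{a,x}=\frac{\partial}{\partial a}M_{a,x}$ (with $x$ fixed). Then there are a constant $c\neq0$ (independent of $a$ and $x$) and a function $s:\mathbb C\to\mathbb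 C$ such that for every $a\in\mathbb C$ with $3a\notin\Lambda$ one has $\theta_0(a)\theta_1(a)\theta_2(a)\neq0$ and, for all $x\in\mathbb C^3$, $$M'_{a,x}=c\,\big(s(a)\,M_{a,x}+M_{-2a,x}\big),$$ where $M_{-2a,x}=M(p,x)$ is the Moore matrix of the point $-2a\in E\subset\mathbb P^2$, formed with its homogeneous coordinates $$p=\frac{1}{\theta_0(a)\theta_1(a)\theta_2(a)}\,\big(\theta_0(-2a),\theta_1(-2a),\theta_2(-2a)\big).$$ (In particular, for each fixed $a$ with $3a\notin\Lambda$, $M'_{a,x}$ is a nonzero multiple of a combination $s\,M(\theta(a),x)+M(\theta(-2a),x)$.) -/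

import Mathlib

/-- The theta functions `θ_0, θ_1, θ_2` of order three for the lattice `ℤ + ℤ τ`, as a series:
`θ_j(z) = ∑_{n ∈ ℤ} (-1)^(n+j) exp(3πiτ (n + j/3 + 1/2)² + 6πi (n + j/3 + 1/2) z)`.
They form a basis of the sections of `𝒪(3o)` and satisfy
`θ_0(-z) = -θ_0(z)`, `θ_1(-z) = -θ_2(z)`, `θ_2(-z) = -θ_1(z)`. -/
noncomputable def hesseTheta (τ : ℂ) (j : Fin 3) (z : ℂ) : ℂ :=
  ∑' n : ℤ, (-1 : ℂ) ^ (n + ((j : ℕ) : ℤ)) *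
    Complex.exp
      (3 * Real.pi * Complex.I * τ * ((n : ℂ) + ((j : ℕ) : ℂ) / 3 + 1 / 2) ^ 2 +
        6 * Real.pi * Complex.I * ((n : ℂ) + ((j : ℕ) : ℂ) / 3 + 1 / 2) * z)

/-- The vector `(θ_0(z), θ_1(z), θ_2(z))`: homogeneous coordinates of the point of the Hesse
cubic with parameter `z`. -/
noncomputable def hesseVec (τ : ℂ) (z : ℂ) : Fin 3 → ℂ :=
  fun j => hesseTheta τ j z

/-- The Moore matrix `M_{a,x}`, for homogeneous coordinates `a` and `x`. -/
def mooreMatrix (a x : Fin 3 → ℂ) : Matrix (Fin 3) (Fin 3) ℂ :=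
  !![a 0 * x 0, a 2 * x 2, a 1 * x 1;
     a 2 * x 1, a 1 * x 0, a 0 * x 2;
     a 1 * x 2, a 0 * x 1, a 2 * x 0]

/-- `a ∈ ℂ` represents a point of order dividing three on `ℂ / (ℤ + ℤ τ)`. -/
def IsThreeTorsion (τ a : ℂ) : Prop :=
  ∃ m n : ℤ, 3 * a = (m : ℂ) + (n : ℂ) * τ

/-! Write `θ_k` for `thetaThree τ k` and `P = θ_0 θ_1 θ_2`. The Moore matrix is linear in `p`, so it
is enough to show `θ_k' = c (s θ_k + P⁻¹ θ_k(-2a))` with `c` and `s` independent of `k`. Splitting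
the double series by parity gives `θ_0(a+b) θ_0(a-b) = u(a)v(b) - v(a)u(b)`, and the Plücker
relation for such 2×2 minors is the three-term relation. Since `θ_k` is, up to an exponential, the
translate of `θ_0` by `kτ/3`, the relation becomes the addition formula `thetaThree_addition`. Its
derivative in `b` at `b = a` is `3 P θ_k' = P' θ_k - K θ_k(-2a)` with `K = θ_1(0) θ_{-1}(0)
θ_0'(0)`, because `θ_0(0) = 0` and `-2k ≡ k` mod 3. The nonvanishing of `P` and `K` also comes from
the three-term relation: it forces `θ_0'(0) ≠ 0` and makes every zero of `θ_0` a quasi-period, which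
confines the zeros to `(1/3)ℤ + ℤτ`. -/

/-- The two-variable kernel `f (a + b) * f (a - b)` of `f` satisfies the Weierstrass three-term
relation. -/
def ThreeTerm (f : ℂ → ℂ) : Prop :=
  ∀ a b c d : ℂ,
    f (a + b) * f (a - b) * (f (c + d) * f (c - d)) -
      f (a + c) * f (a - c) * (f (b + d) * f (b - d)) +
      f (a + d) * f (a - d) * (f (b + c) * f (b - c)) = 0

/-! ### Entire functions: Wronskians and products. -/

theorem exists_eq_const_mul_of_wronskian_eq_zero {f g : ℂ → ℂ} (hf : Differentiable ℂ f)
    (hg : Differentiable ℂ g) (h : ∀ x, deriv f x * g x = f x * deriv g x)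
    {x₀ : ℂ} (hx₀ : g x₀ ≠ 0) : ∃ C : ℂ, ∀ x, f x = C * g x := by
  obtain ⟨r, hr, hball⟩ := Metric.eventually_nhds_iff_ball.1
    (hg.continuous.continuousAt.eventually_ne hx₀)
  have hderiv : ∀ x ∈ Metric.ball x₀ r, HasDerivAt (fun x => f x / g x) 0 x := by
    intro x hx
    have := (hf x).hasDerivAt.div (hg x).hasDerivAt (hball x hx)
    rwa [h x, sub_self, zero_div] at this
  obtain ⟨C, hC⟩ := Metric.isOpen_ball.exists_is_const_of_deriv_eq_zero
    (convex_ball x₀ r).isPreconnected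
    (fun x hx => (hderiv x hx).differentiableAt.differentiableWithinAt)
    (fun x hx => (hderiv x hx).deriv)
  refine ⟨C, fun x => ?_⟩
  have hA : AnalyticOnNhd ℂ f Set.univ := fun x _ => hf.analyticAt x
  have hB : AnalyticOnNhd ℂ (fun x => C * g x) Set.univ :=
    fun x _ => (hg.const_mul C).analyticAt x
  refine congrFun (hA.eq_of_eventuallyEq (z₀ := x₀) hB ?_) x
  filter_upwards [Metric.ball_mem_nhds x₀ hr] with y hy
  rw [← hC y hy, div_mul_cancel₀ _ (hball y hy)]

theorem exists_mul_ne_zero {f g : ℂ → ℂ} (hf : Differentiable ℂ f) (hg : Differentiable ℂ g)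
    (hf₀ : ∃ x, f x ≠ 0) (hg₀ : ∃ x, g x ≠ 0) : ∃ x, f x ≠ 0 ∧ g x ≠ 0 := by
  by_contra! hcon
  have hA : AnalyticOnNhd ℂ f Set.univ := fun x _ => hf.analyticAt x
  have hB : AnalyticOnNhd ℂ g Set.univ := fun x _ => hg.analyticAt x
  obtain ⟨x, hx⟩ := hf₀
  obtain ⟨y, hy⟩ := hg₀
  rcases hA.eq_zero_or_eq_zero_of_mul_eq_zero hB
    (fun z _ => by
      by_cases hz : f z = 0
      · rw [hz, zero_mul]
      · rw [hcon z hz, mul_zero]) isPreconnected_univ with h | h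
  · exact hx (h x trivial)
  · exact hy (h y trivial)

/-! ### Consequences of the three-term relation. -/

namespace ThreeTerm

variable {f : ℂ → ℂ}

theorem map_zero (h : ThreeTerm f) (h₀ : ∃ x, f x ≠ 0) : f 0 = 0 := by
  obtain ⟨x, hx⟩ := h₀
  have := h (x / 2) (x / 2) (x / 2) (x / 2)
  simpa [hx] using this

theorem map_neg (h : ThreeTerm f) (h₀ : ∃ x, f x ≠ 0) (x : ℂ) : f (-x) = -f x := by
  have hz := h.map_zero h₀
  obtain ⟨y, hy⟩ := h₀
  -- Exchanging `c` and `d` flips the sign of the last two terms together, so they cancel in the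
  -- sum.
  have h1 := h y 0 ((x + y) / 2) ((y - x) / 2)
  have h2 := h y 0 ((y - x) / 2) ((x + y) / 2)
  have e1 : (x + y) / 2 + (y - x) / 2 = y := by ring
  have e2 : (x + y) / 2 - (y - x) / 2 = x := by ring
  have e3 : (y - x) / 2 + (x + y) / 2 = y := by ring
  have e4 : (y - x) / 2 - (x + y) / 2 = -x := by ring
  simp only [e1, e2, e3, e4, add_zero, sub_zero] at h1 h2
  have : f y * f y * f y * (f (-x) + f x) = 0 := by linear_combination h1 + h2
  have h3 : f (-x) + f x = 0 := by simpa [hy] using this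
  linear_combination h3

/-- If `f'(0) = 0`, differentiating the relation in `b` at `b = a` kills the first term. All
functions `a ↦ f(a+c) f(a-c)` are then proportional; comparing `c = x₀` with `c = 0` at `a = 0`
gives `f(x₀) f(-x₀) = 0`. -/
theorem deriv_zero_ne_zero (h : ThreeTerm f) (hf : Differentiable ℂ f) (h₀ : ∃ x, f x ≠ 0) :
    deriv f 0 ≠ 0 := by
  intro hd
  have hz := h.map_zero h₀
  have hneg := h.map_neg h₀
  obtain ⟨x₀, hx₀⟩ := h₀
  have hK : ∀ c : ℂ, Differentiable ℂ fun a => f (a + c) * f (a - c) := fun c =>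
    (hf.comp (differentiable_id.add_const c)).mul (hf.comp (differentiable_id.sub_const c))
  have key : ∀ a c d : ℂ, deriv (fun a => f (a + d) * f (a - d)) a * (f (a + c) * f (a - c)) =
      f (a + d) * f (a - d) * deriv (fun a => f (a + c) * f (a - c)) a := by
    intro a c d
    have h1 : HasDerivAt (fun b => f (a + b) * f (a - b)) 0 a := by
      have e1 : HasDerivAt (fun b => f (a + b)) (deriv f (a + a)) a :=
        (hf (a + a)).hasDerivAt.comp_const_add a a
      have e2 : HasDerivAt (fun b => f (a - b)) (-deriv f (a - a)) a :=
        (hf (a - a)).hasDerivAt.comp_const_sub a a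
      exact (e1.mul e2).congr_deriv (by simp [hz, hd])
    have h2 := ((h1.mul_const (f (c + d) * f (c - d))).sub
      ((hK d a).hasDerivAt.const_mul (f (a + c) * f (a - c)))).add
      ((hK c a).hasDerivAt.const_mul (f (a + d) * f (a - d)))
    have h3 := h2.unique ((hasDerivAt_const a (0 : ℂ)).congr_of_eventuallyEq
      (Filter.Eventually.of_forall fun b => h a b c d))
    linear_combination -h3
  obtain ⟨C, hC⟩ := exists_eq_const_mul_of_wronskian_eq_zero (hK x₀) (hK 0)
    (fun a => key a 0 x₀) (x₀ := x₀) (by simpa using hx₀)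
  have := hC 0
  simp [hz, hneg, hx₀] at this

/-- A zero of an entire solution of the three-term relation is an exponential quasi-period. -/
theorem exists_map_add_eq (h : ThreeTerm f) (hf : Differentiable ℂ f) (h₀ : ∃ x, f x ≠ 0)
    {w : ℂ} (hw : f w = 0) :
    ∃ C α : ℂ, ∀ x, f (x + w) = C * Complex.exp (α * x) * f x := by
  have hneg := h.map_neg h₀
  have hfw : Differentiable ℂ fun x => f (x + w) := hf.comp (differentiable_id.add_const w)
  have key : ∀ x y, (deriv f (x + w) * f x - f (x + w) * deriv f x) * (f y * f (y + w)) =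
      (deriv f (y + w) * f y - f (y + w) * deriv f y) * (f x * f (x + w)) := by
    intro x y
    have h1 : ∀ t, f (x + w + t) * f (y + w - t) * (f x * f y) =
        f (x + w) * f (y + w) * (f (x + t) * f (y - t)) := by
      intro t
      -- Chosen so that one factor of the middle term is `f w = 0`, leaving a two-term identity. Its
      -- derivative at `t = 0` says that the logarithmic derivative of `f(x+w)/f(x)` does not depend
      -- on `x`; this constant is `α`.
      have := h ((x + y) / 2 + w) ((x - y) / 2 + t) ((x + y) / 2) ((x - y) / 2)
      have e1 : (x + y) / 2 + w + ((x - y) / 2 + t) = x + w + t := by ring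
      have e2 : (x + y) / 2 + w - ((x - y) / 2 + t) = y + w - t := by ring
      have e3 : (x + y) / 2 + (x - y) / 2 = x := by ring
      have e4 : (x + y) / 2 - (x - y) / 2 = y := by ring
      have e5 : (x + y) / 2 + w - (x + y) / 2 = w := by ring
      have e6 : (x + y) / 2 + w + (x - y) / 2 = x + w := by ring
      have e7 : (x + y) / 2 + w - (x - y) / 2 = y + w := by ring
      have e8 : (x - y) / 2 + t + (x + y) / 2 = x + t := by ring
      have e9 : (x - y) / 2 + t - (x + y) / 2 = -(y - t) := by ring
      rw [e1, e2, e3, e4, e5, e6, e7, e8, e9, hneg, hw] at this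
      linear_combination this
    have hplus : ∀ u, HasDerivAt (fun t => f (u + t)) (deriv f u) 0 := fun u => by
      have := (hf (u + 0)).hasDerivAt.comp_const_add u 0
      rwa [add_zero] at this
    have hminus : ∀ u, HasDerivAt (fun t => f (u - t)) (-deriv f u) 0 := fun u => by
      have := (hf (u - 0)).hasDerivAt.comp_const_sub u 0
      rwa [sub_zero] at this
    have h2 := ((hplus (x + w)).mul (hminus (y + w))).mul_const (f x * f y)
    have h3 := ((hplus x).mul (hminus y)).const_mul (f (x + w) * f (y + w))
    have h4 := h2.unique (h3.congr_of_eventuallyEq (Filter.Eventually.of_forall h1))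
    simp only [add_zero, sub_zero] at h4
    linear_combination h4
  have h₀w : ∃ x, f (x + w) ≠ 0 := h₀.imp' (· - w) (fun x hx => by simpa using hx)
  obtain ⟨y, hy, hyw⟩ := exists_mul_ne_zero hf hfw h₀ h₀w
  set α := (deriv f (y + w) * f y - f (y + w) * deriv f y) / (f y * f (y + w)) with hα
  have hexp : Differentiable ℂ fun x => Complex.exp (-α * x) :=
    (differentiable_id.const_mul (-α)).cexp
  obtain ⟨C, hC⟩ := exists_eq_const_mul_of_wronskian_eq_zero (hfw.mul hexp) hf
    (fun x => by
      have e1 : HasDerivAt (fun x => f (x + w)) (deriv f (x + w)) x :=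
        (hf (x + w)).hasDerivAt.comp_add_const x w
      have e2 : HasDerivAt (fun x => Complex.exp (-α * x)) (Complex.exp (-α * x) * -α) x := by
        simpa using ((hasDerivAt_id x).const_mul (-α)).cexp
      have e3 : deriv f (x + w) * f x - f (x + w) * deriv f x = α * (f x * f (x + w)) := by
        rw [hα, div_mul_eq_mul_div, eq_div_iff (mul_ne_zero hy hyw)]
        exact key x y
      have e4 := (e1.mul e2).deriv
      rw [e4]
      simp only [Pi.mul_apply]
      linear_combination Complex.exp (-α * x) * e3) hy
  refine ⟨C, α, fun x => ?_⟩
  have := hC x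
  simp only [Pi.mul_apply] at this
  have e : Complex.exp (-α * x) * Complex.exp (α * x) = 1 := by
    rw [← Complex.exp_add]; simp
  linear_combination Complex.exp (α * x) * this - f (x + w) * e

end ThreeTerm

/-! ### Theta series with characteristics. -/

/-- The integral over the period `[0, 1]` is the zeroth Fourier coefficient, which is 1. -/
theorem exists_jacobiTheta₂_ne_zero {σ : ℂ} (hσ : 0 < σ.im) : ∃ z, jacobiTheta₂ z σ ≠ 0 := by
  by_contra! hzero
  have h1 : HasSum (fun n : ℤ => ∫ x in (0 : ℝ)..1, jacobiTheta₂_term n x σ)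
      (∫ x in (0 : ℝ)..1, jacobiTheta₂ x σ) := by
    refine intervalIntegral.hasSum_integral_of_dominated_convergence
      (fun n _ => ‖jacobiTheta₂_term n 0 σ‖) (fun n => ?_) (fun n => ?_) ?_ ?_ ?_
    · refine Continuous.aestronglyMeasurable ?_
      unfold jacobiTheta₂_term
      fun_prop
    · refine Filter.Eventually.of_forall fun x _ => le_of_eq ?_
      simp [norm_jacobiTheta₂_term]
    · exact Filter.Eventually.of_forall fun x _ =>
        ((summable_jacobiTheta₂_term_iff 0 σ).2 hσ).norm
    · exact intervalIntegrable_const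
    · exact Filter.Eventually.of_forall fun x _ => hasSum_jacobiTheta₂_term x hσ
  have h2 : ∀ n : ℤ, n ≠ 0 → ∫ x in (0 : ℝ)..1, jacobiTheta₂_term n x σ = 0 := by
    intro n hn
    have hc : 2 * Real.pi * Complex.I * n ≠ 0 := by
      simp [Real.pi_ne_zero, hn]
    simp only [jacobiTheta₂_term, Complex.exp_add, intervalIntegral.integral_mul_const,
      integral_exp_mul_complex hc]
    have : Complex.exp (2 * Real.pi * Complex.I * n * (1 : ℝ)) = 1 :=
      Complex.exp_eq_one_iff.2 ⟨n, by push_cast; ring⟩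
    rw [this]
    simp
  have h3 := h1.unique (hasSum_single 0 h2)
  simp [hzero, jacobiTheta₂_term] at h3

/-- The bijection of two copies of `ℤ × ℤ` with `ℤ × ℤ`, onto the pairs with even and odd sum. -/
theorem bijective_sum_add_sub :
    Function.Bijective (Sum.elim (fun p : ℤ × ℤ => (p.1 + p.2, p.1 - p.2))
      (fun p : ℤ × ℤ => (p.1 + p.2, p.1 - p.2 - 1))) := by
  constructor
  · rintro (⟨a, b⟩ | ⟨a, b⟩) (⟨c, d⟩ | ⟨c, d⟩) h <;>
      simp only [Sum.elim_inl, Sum.elim_inr, Prod.mk.injEq] at h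
    · obtain ⟨rfl, rfl⟩ : a = c ∧ b = d := by omega
      rfl
    · omega
    · omega
    · obtain ⟨rfl, rfl⟩ : a = c ∧ b = d := by omega
      rfl
  · rintro ⟨m, n⟩
    rcases Int.even_or_odd' (m + n) with ⟨k, hk | hk⟩
    · exact ⟨Sum.inl (k, m - k), by simp; omega⟩
    · exact ⟨Sum.inr (k + 1, m - k - 1), by simp; omega⟩

/-- The term of index `n` of the theta series with characteristic `r`. -/
noncomputable def thetaCharTerm (r σ z : ℂ) (n : ℤ) : ℂ :=
  Complex.exp (Real.pi * Complex.I * σ * (n + r) ^ 2 + 2 * Real.pi * Complex.I * (n + r) * z)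

theorem thetaCharTerm_eq (r σ z : ℂ) (n : ℤ) : thetaCharTerm r σ z n =
    Complex.exp (Real.pi * Complex.I * σ * r ^ 2 + 2 * Real.pi * Complex.I * r * z) *
      jacobiTheta₂_term n (z + r * σ) σ := by
  rw [thetaCharTerm, jacobiTheta₂_term, ← Complex.exp_add]
  ring_nf

theorem summable_thetaCharTerm (r z : ℂ) {σ : ℂ} (hσ : 0 < σ.im) :
    Summable (thetaCharTerm r σ z) := by
  have := ((summable_jacobiTheta₂_term_iff (z + r * σ) σ).2 hσ).mul_left
    (Complex.exp (Real.pi * Complex.I * σ * r ^ 2 + 2 * Real.pi * Complex.I * r * z))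
  exact this.congr fun n => (thetaCharTerm_eq r σ z n).symm

/-! ### Order-three theta functions: symmetries and translation. -/

/-- The theta function `θ_k` of order three, for an arbitrary integer index `k`. -/
noncomputable def thetaThree (τ : ℂ) (k : ℤ) (z : ℂ) : ℂ :=
  ∑' n : ℤ, (-1 : ℂ) ^ (n + k) *
    Complex.exp
      (3 * Real.pi * Complex.I * τ * ((n : ℂ) + (k : ℂ) / 3 + 1 / 2) ^ 2 +
        6 * Real.pi * Complex.I * ((n : ℂ) + (k : ℂ) / 3 + 1 / 2) * z)

theorem hesseTheta_eq_thetaThree (τ : ℂ) (j : Fin 3) (z : ℂ) :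
    hesseTheta τ j z = thetaThree τ ((j : ℕ) : ℤ) z := by
  simp [hesseTheta, thetaThree]

theorem thetaThree_add_three (τ : ℂ) (k : ℤ) (z : ℂ) :
    thetaThree τ (k + 3) z = thetaThree τ k z := by
  unfold thetaThree
  symm
  rw [← (Equiv.addRight (1 : ℤ)).tsum_eq]
  refine tsum_congr fun n => ?_
  have h1 : (-1 : ℂ) ^ (n + 1 + k) = (-1 : ℂ) ^ (n + (k + 3)) := by
    rw [show n + (k + 3) = n + 1 + k + 2 by ring, zpow_add₀ (by norm_num) _ 2]
    norm_num
  rw [Equiv.coe_addRight, h1]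
  congr 2
  push_cast
  ring

theorem neg_one_zpow_eq_exp (n : ℤ) : (-1 : ℂ) ^ n = Complex.exp (n * (Real.pi * Complex.I)) := by
  rw [Complex.exp_int_mul, Complex.exp_pi_mul_I]

theorem thetaThree_neg (τ : ℂ) (k : ℤ) (z : ℂ) :
    thetaThree τ (-k) (-z) = -thetaThree τ k z := by
  unfold thetaThree
  rw [← tsum_neg, ← (Equiv.subLeft (-1 : ℤ)).tsum_eq]
  refine tsum_congr fun n => ?_
  rw [Equiv.subLeft_apply]
  have h1 : (-1 : ℂ) ^ (-1 - n + -k) = -(-1 : ℂ) ^ (n + k) := by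
    rw [show -1 - n + -k = -(n + k) - 1 by ring, zpow_sub_one₀ (by norm_num), zpow_neg,
      ← inv_zpow]
    norm_num
  rw [h1, neg_mul]
  push_cast
  ring_nf

theorem thetaThree_eq (τ : ℂ) (k : ℤ) (z : ℂ) :
    thetaThree τ k z = (-1) ^ k *
      Complex.exp (Real.pi * Complex.I * τ * k ^ 2 / 3 + 2 * Real.pi * Complex.I * k * z) *
      thetaThree τ 0 (z + k * (τ / 3)) := by
  unfold thetaThree
  rw [← tsum_mul_left]
  refine tsum_congr fun n => ?_
  rw [zpow_add₀ (by norm_num), add_zero, mul_mul_mul_comm, ← Complex.exp_add,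
    mul_comm ((-1 : ℂ) ^ n)]
  congr 2
  push_cast
  ring

theorem thetaThree_zero_add_third (τ z : ℂ) :
    thetaThree τ 0 (z + 1 / 3) = -thetaThree τ 0 z := by
  unfold thetaThree
  rw [← tsum_neg]
  refine tsum_congr fun n => ?_
  have : Complex.exp (2 * Real.pi * Complex.I * n + Real.pi * Complex.I) = -1 := by
    rw [Complex.exp_add, Complex.exp_pi_mul_I, Complex.exp_eq_one_iff.2 ⟨n, by ring⟩, one_mul]
  rw [← mul_neg, ← mul_neg_one (Complex.exp _), ← this, ← Complex.exp_add]
  congr 2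
  push_cast
  ring

theorem thetaThree_zero_eq_quasiperiod (τ z : ℂ) :
    thetaThree τ 0 z = -Complex.exp (3 * Real.pi * Complex.I * τ + 6 * Real.pi * Complex.I * z) *
      thetaThree τ 0 (z + τ) := by
  rw [← thetaThree_add_three τ 0 z, zero_add, thetaThree_eq τ 3]
  push_cast
  ring_nf

theorem thetaThree_term_eq (τ z : ℂ) (n : ℤ) : (-1 : ℂ) ^ (n + 0) *
    Complex.exp
      (3 * Real.pi * Complex.I * τ * ((n : ℂ) + ((0 : ℤ) : ℂ) / 3 + 1 / 2) ^ 2 +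
        6 * Real.pi * Complex.I * ((n : ℂ) + ((0 : ℤ) : ℂ) / 3 + 1 / 2) * z) =
    Complex.exp (-(Real.pi * Complex.I / 2)) * thetaCharTerm (1 / 2) (3 * τ) (3 * z + 1 / 2) n := by
  rw [neg_one_zpow_eq_exp, thetaCharTerm, ← Complex.exp_add, ← Complex.exp_add]
  congr 1
  push_cast
  ring

theorem thetaThree_zero_eq_jacobiTheta₂ (τ z : ℂ) :
    thetaThree τ 0 z = Complex.exp (-(Real.pi * Complex.I / 2)) *
      (Complex.exp (Real.pi * Complex.I * (3 * τ) * (1 / 2) ^ 2 +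
        2 * Real.pi * Complex.I * (1 / 2) * (3 * z + 1 / 2)) *
      jacobiTheta₂ (3 * z + 1 / 2 + 1 / 2 * (3 * τ)) (3 * τ)) := by
  rw [thetaThree, jacobiTheta₂, ← tsum_mul_left, ← tsum_mul_left]
  refine tsum_congr fun n => ?_
  rw [thetaThree_term_eq, thetaCharTerm_eq]

theorem im_three_mul_pos {τ : ℂ} (hτ : 0 < τ.im) : 0 < (3 * τ).im := by
  simpa using hτ

theorem differentiable_thetaThree_zero {τ : ℂ} (hτ : 0 < τ.im) :
    Differentiable ℂ (thetaThree τ 0) := by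
  have hJ : Differentiable ℂ fun z => jacobiTheta₂ z (3 * τ) := fun z =>
    differentiableAt_jacobiTheta₂_fst z (im_three_mul_pos hτ)
  have hl : Differentiable ℂ fun z : ℂ => 3 * z + 1 / 2 + 1 / 2 * (3 * τ) := by fun_prop
  have := hJ.comp hl
  rw [funext (thetaThree_zero_eq_jacobiTheta₂ τ)]
  exact (((by fun_prop : Differentiable ℂ fun z : ℂ =>
    Complex.exp (Real.pi * Complex.I * (3 * τ) * (1 / 2) ^ 2 +
        2 * Real.pi * Complex.I * (1 / 2) * (3 * z + 1 / 2)))).mul this).const_mul _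

theorem differentiable_thetaThree {τ : ℂ} (hτ : 0 < τ.im) (k : ℤ) :
    Differentiable ℂ (thetaThree τ k) := by
  have := (differentiable_thetaThree_zero hτ).comp
    (by fun_prop : Differentiable ℂ fun z : ℂ => z + k * (τ / 3))
  rw [funext (thetaThree_eq τ k)]
  exact (by fun_prop : Differentiable ℂ fun z : ℂ => (-1) ^ k *
      Complex.exp (Real.pi * Complex.I * τ * k ^ 2 / 3 + 2 * Real.pi * Complex.I * k * z)).mul this

theorem exists_thetaThree_zero_ne_zero {τ : ℂ} (hτ : 0 < τ.im) :
    ∃ z, thetaThree τ 0 z ≠ 0 := by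
  obtain ⟨w, hw⟩ := exists_jacobiTheta₂_ne_zero (im_three_mul_pos hτ)
  refine ⟨(w - 1 / 2 - 1 / 2 * (3 * τ)) / 3, ?_⟩
  rw [thetaThree_zero_eq_jacobiTheta₂]
  refine mul_ne_zero (Complex.exp_ne_zero _) (mul_ne_zero (Complex.exp_ne_zero _) ?_)
  convert hw using 2
  ring

/-! ### The three-term relation for `θ_0` and its zeros. -/

theorem thetaThree_zero_add_mul_sub {τ : ℂ} (hτ : 0 < τ.im) :
    ∃ u v : ℂ → ℂ, ∀ a b,
      thetaThree τ 0 (a + b) * thetaThree τ 0 (a - b) = u a * v b - v a * u b := by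
  have h6 : 0 < (6 * τ).im := by simpa using hτ
  set t : ℂ → ℤ → ℂ := fun z n =>
    (-1 : ℂ) ^ (n + 0) * Complex.exp
      (3 * Real.pi * Complex.I * τ * ((n : ℂ) + ((0 : ℤ) : ℂ) / 3 + 1 / 2) ^ 2 +
        6 * Real.pi * Complex.I * ((n : ℂ) + ((0 : ℤ) : ℂ) / 3 + 1 / 2) * z) with ht_def
  have ht : ∀ z, Summable (fun n => ‖t z n‖) := fun z =>
    (((summable_thetaCharTerm (1 / 2) (3 * z + 1 / 2) (im_three_mul_pos hτ)).mul_left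
      (Complex.exp (-(Real.pi * Complex.I / 2)))).congr
      fun n => (thetaThree_term_eq τ z n).symm).norm
  have ho : ∀ z, Summable (fun n => ‖thetaCharTerm (1 / 2) (6 * τ) (6 * z) n‖) := fun z =>
    (summable_thetaCharTerm _ _ h6).norm
  have he : ∀ z, Summable (fun n => ‖thetaCharTerm 0 (6 * τ) (6 * z) n‖) := fun z =>
    (summable_thetaCharTerm _ _ h6).norm
  refine ⟨fun z => ∑' n, thetaCharTerm (1 / 2) (6 * τ) (6 * z) n,
    fun z => ∑' n, thetaCharTerm 0 (6 * τ) (6 * z) n, fun a b => ?_⟩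
  -- With `m = k + l`, `n = k - l`, the half-integers `m + 1/2`, `n + 1/2` have half-sum `k + 1/2`
  -- and half-difference `l`. In `hinr` these become `k` and `l + 1/2`, and the sign is odd.
  have hinl : ∀ p : ℤ × ℤ, t (a + b) (p.1 + p.2) * t (a - b) (p.1 - p.2) =
      thetaCharTerm (1 / 2) (6 * τ) (6 * a) p.1 * thetaCharTerm 0 (6 * τ) (6 * b) p.2 := by
    rintro ⟨k, l⟩
    simp only [ht_def, thetaCharTerm]
    rw [mul_mul_mul_comm, ← zpow_add₀ (by norm_num), ← Complex.exp_add, ← Complex.exp_add,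
      Even.neg_one_zpow ⟨k, by ring⟩, one_mul]
    congr 1
    push_cast
    ring
  have hinr : ∀ p : ℤ × ℤ, t (a + b) (p.1 + p.2) * t (a - b) (p.1 - p.2 - 1) =
      -(thetaCharTerm 0 (6 * τ) (6 * a) p.1 * thetaCharTerm (1 / 2) (6 * τ) (6 * b) p.2) := by
    rintro ⟨k, l⟩
    simp only [ht_def, thetaCharTerm]
    rw [mul_mul_mul_comm, ← zpow_add₀ (by norm_num), ← Complex.exp_add, ← Complex.exp_add,
      Odd.neg_one_zpow ⟨k - 1, by ring⟩, neg_one_mul]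
    congr 2
    push_cast
    ring
  have hsum := summable_mul_of_summable_norm (ht (a + b)) (ht (a - b))
  rw [tsum_mul_tsum_of_summable_norm (ho a) (he b), tsum_mul_tsum_of_summable_norm (he a) (ho b)]
  unfold thetaThree
  rw [tsum_mul_tsum_of_summable_norm (ht (a + b)) (ht (a - b)),
    ← (Equiv.ofBijective _ bijective_sum_add_sub).tsum_eq]
  have hl := summable_mul_of_summable_norm (ho a) (he b)
  have hr := summable_mul_of_summable_norm (he a) (ho b)
  rw [Summable.tsum_sum]
  · simp only [Equiv.ofBijective_apply, Sum.elim_inl, Sum.elim_inr]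
    rw [tsum_congr hinl, tsum_congr hinr, tsum_neg, sub_eq_add_neg]
  · simp only [Function.comp_def, Equiv.ofBijective_apply, Sum.elim_inl]
    exact hl.congr fun p => (hinl p).symm
  · simp only [Function.comp_def, Equiv.ofBijective_apply, Sum.elim_inr]
    exact hr.neg.congr fun p => (hinr p).symm

theorem threeTerm_thetaThree_zero {τ : ℂ} (hτ : 0 < τ.im) : ThreeTerm (thetaThree τ 0) := by
  obtain ⟨u, v, huv⟩ := thetaThree_zero_add_mul_sub hτ
  intro a b c d
  simp only [huv]
  ring

/-- The factor `C exp(αx)` of translation by `w` must be compatible with translation by `1/3` and by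
`τ`. This gives `α ∈ 6πiℤ` and `6πiw + ατ ∈ 2πiℤ`. -/
theorem exists_three_mul_eq_of_thetaThree_zero_eq_zero {τ : ℂ} (hτ : 0 < τ.im) {w : ℂ}
    (hw : thetaThree τ 0 w = 0) : ∃ m n : ℤ, 3 * w = m + n * (3 * τ) := by
  obtain ⟨C, α, hC⟩ := (threeTerm_thetaThree_zero hτ).exists_map_add_eq
    (differentiable_thetaThree_zero hτ) (exists_thetaThree_zero_ne_zero hτ) hw
  obtain ⟨x, hx⟩ := exists_thetaThree_zero_ne_zero hτ
  have hC0 : C ≠ 0 := by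
    rintro rfl
    have := hC (x - w)
    simp [hx] at this
  have hne : C * Complex.exp (α * x) * thetaThree τ 0 x ≠ 0 :=
    mul_ne_zero (mul_ne_zero hC0 (Complex.exp_ne_zero _)) hx
  have h1 : Complex.exp (α * (1 / 3)) = 1 := by
    have e1 := hC (x + 1 / 3)
    rw [add_right_comm, thetaThree_zero_add_third, thetaThree_zero_add_third, hC, mul_add,
      Complex.exp_add] at e1
    refine mul_left_cancel₀ hne ?_
    linear_combination e1
  have h2 : Complex.exp (6 * Real.pi * Complex.I * w + α * τ) = 1 := by
    have e1 := hC (x + τ)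
    have e2 := thetaThree_zero_eq_quasiperiod τ (x + w)
    have e3 := thetaThree_zero_eq_quasiperiod τ x
    rw [add_right_comm, e1, hC] at e2
    simp only [mul_add, Complex.exp_add] at e2 e3 ⊢
    refine mul_left_cancel₀ hne ?_
    linear_combination C * Complex.exp (α * x) * Complex.exp (6 * Real.pi * Complex.I * w) *
      Complex.exp (α * τ) * e3 - e2
  obtain ⟨k, hk⟩ := Complex.exp_eq_one_iff.1 h1
  obtain ⟨m, hm⟩ := Complex.exp_eq_one_iff.1 h2
  refine ⟨m, -k, ?_⟩
  have hpi : (2 * Real.pi * Complex.I : ℂ) ≠ 0 := Complex.two_pi_I_ne_zero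
  refine mul_left_cancel₀ hpi ?_
  push_cast
  linear_combination hm - 3 * τ * hk

theorem thetaThree_ne_zero {τ : ℂ} (hτ : 0 < τ.im) {a : ℂ} (ha : ¬ IsThreeTorsion τ a) (k : ℤ) :
    thetaThree τ k a ≠ 0 := by
  intro h0
  rw [thetaThree_eq] at h0
  have h1 : thetaThree τ 0 (a + k * (τ / 3)) = 0 := by
    simpa [zpow_ne_zero, Complex.exp_ne_zero] using h0
  obtain ⟨m, n, h⟩ := exists_three_mul_eq_of_thetaThree_zero_eq_zero hτ h1
  refine ha ⟨m, 3 * n - k, ?_⟩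
  push_cast
  linear_combination h

theorem thetaThree_one_zero_ne_zero {τ : ℂ} (hτ : 0 < τ.im) :
    thetaThree τ 1 0 ≠ 0 := by
  intro h0
  rw [thetaThree_eq] at h0
  have h1 : thetaThree τ 0 (0 + (1 : ℤ) * (τ / 3)) = 0 := by
    simpa [zpow_ne_zero, Complex.exp_ne_zero] using h0
  obtain ⟨m, n, h⟩ := exists_three_mul_eq_of_thetaThree_zero_eq_zero hτ h1
  have him := congrArg Complex.im h
  have : τ.im * (1 - 3 * n) = 0 := by
    simp at him
    linarith
  rcases mul_eq_zero.1 this with h | h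
  · exact hτ.ne' h
  · have : (1 : ℤ) - 3 * n = 0 := by exact_mod_cast h
    omega

/-! ### Addition formula and derivatives. -/

theorem thetaThree_addition {τ : ℂ} (hτ : 0 < τ.im) (k : ℤ) (a b : ℂ) :
    thetaThree τ 1 0 * thetaThree τ (-1) 0 *
      (thetaThree τ (2 * k) (a + b) * thetaThree τ 0 (a - b)) =
    thetaThree τ k a ^ 2 * (thetaThree τ (k + 1) b * thetaThree τ (k - 1) b) -
      thetaThree τ (k + 1) a * thetaThree τ (k - 1) a * thetaThree τ k b ^ 2 := by
  obtain ⟨E, hE⟩ : ∃ E : ℤ → ℂ → ℂ, ∀ k z, E k z =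
      Complex.exp (Real.pi * Complex.I * τ * k ^ 2 / 3 + 2 * Real.pi * Complex.I * k * z) :=
    ⟨_, fun _ _ => rfl⟩
  have hθ : ∀ k z, thetaThree τ k z = (-1) ^ k * E k z * thetaThree τ 0 (z + k * (τ / 3)) :=
    fun k z => by rw [hE, ← thetaThree_eq]
  have hs : ((-1 : ℂ) ^ k) ^ 2 = 1 := by
    rw [← zpow_natCast, ← zpow_mul, Even.neg_one_zpow ⟨k, by push_cast; ring⟩]
  have hθp : ∀ z, thetaThree τ (k + 1) z =
      -(-1) ^ k * E (k + 1) z * thetaThree τ 0 (z + k * (τ / 3) + τ / 3) := fun z => by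
    rw [hθ (k + 1), zpow_add_one₀ (by norm_num), mul_neg_one]
    push_cast
    ring_nf
  have hθm : ∀ z, thetaThree τ (k - 1) z =
      -(-1) ^ k * E (k - 1) z * thetaThree τ 0 (z + k * (τ / 3) - τ / 3) := fun z => by
    rw [hθ (k - 1), zpow_sub_one₀ (by norm_num), inv_neg_one, mul_neg_one]
    push_cast
    ring_nf
  have hθ2 : thetaThree τ (2 * k) (a + b) = E (2 * k) (a + b) *
      thetaThree τ 0 (a + k * (τ / 3) + (b + k * (τ / 3))) := by
    rw [hθ (2 * k), Even.neg_one_zpow ⟨k, by ring⟩]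
    push_cast
    ring_nf
  have hθ1 : thetaThree τ 1 0 = -E 1 0 * thetaThree τ 0 (0 + τ / 3) := by
    rw [hθ 1]
    simp
  have hθ1' : thetaThree τ (-1) 0 = -E (-1) 0 * thetaThree τ 0 (0 - τ / 3) := by
    rw [hθ (-1)]
    simp
  obtain ⟨G, hG⟩ : ∃ G : ℂ, G = Complex.exp (2 * Real.pi * Complex.I * τ / 3 +
    4 * Real.pi * Complex.I * τ * k ^ 2 / 3 + 4 * Real.pi * Complex.I * k * (a + b)) := ⟨_, rfl⟩
  have hsquare : ∀ y z, E k y ^ 2 * (E (k + 1) z * E (k - 1) z) =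
      Complex.exp (2 * Real.pi * Complex.I * τ / 3 +
        4 * Real.pi * Complex.I * τ * k ^ 2 / 3 + 4 * Real.pi * Complex.I * k * (y + z)) := by
    intro y z
    simp only [hE, sq (Complex.exp _), ← Complex.exp_add]
    congr 1
    push_cast
    ring
  have hG1 : E 1 0 * E (-1) 0 * E (2 * k) (a + b) = G := by
    simp only [hG, hE, ← Complex.exp_add]
    congr 1
    push_cast
    ring
  have hG2 : E k a ^ 2 * (E (k + 1) b * E (k - 1) b) = G := by rw [hsquare, hG]
  have hG3 : E k b ^ 2 * (E (k + 1) a * E (k - 1) a) = G := by rw [hsquare, hG, add_comm b a]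
  -- The arguments `0` and `τ/3` produce the squares and the neighbours `k ± 1`; all three terms
  -- carry the same exponential `G`.
  have h := threeTerm_thetaThree_zero hτ (a + k * (τ / 3)) (b + k * (τ / 3)) 0 (τ / 3)
  simp only [add_zero, sub_zero, add_sub_add_right_eq_sub] at h
  rw [hθ1, hθ1', hθ2, hθp, hθm, hθp, hθm, hθ k a, hθ k b]
  generalize thetaThree τ 0 (a + k * (τ / 3) + (b + k * (τ / 3))) = f₁ at h ⊢
  generalize thetaThree τ 0 (a - b) = f₂ at h ⊢
  generalize thetaThree τ 0 (0 + τ / 3) = f₃ at h ⊢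
  generalize thetaThree τ 0 (0 - τ / 3) = f₄ at h ⊢
  generalize thetaThree τ 0 (a + k * (τ / 3) + τ / 3) = f₅ at h ⊢
  generalize thetaThree τ 0 (a + k * (τ / 3) - τ / 3) = f₆ at h ⊢
  generalize thetaThree τ 0 (b + k * (τ / 3) + τ / 3) = f₇ at h ⊢
  generalize thetaThree τ 0 (b + k * (τ / 3) - τ / 3) = f₈ at h ⊢
  generalize thetaThree τ 0 (a + k * (τ / 3)) = x at h ⊢
  generalize thetaThree τ 0 (b + k * (τ / 3)) = y at h ⊢
  generalize (-1 : ℂ) ^ k = s at hs ⊢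
  have hs4 : s ^ 4 = 1 := by linear_combination (s ^ 2 + 1) * hs
  linear_combination G * h + f₁ * f₂ * f₃ * f₄ * hG1 - s ^ 4 * x ^ 2 * f₇ * f₈ * hG2 +
    s ^ 4 * y ^ 2 * f₅ * f₆ * hG3 - G * (x ^ 2 * f₇ * f₈ - y ^ 2 * f₅ * f₆) * hs4

theorem deriv_thetaThree {τ : ℂ} (hτ : 0 < τ.im) (k : ℤ) (a : ℂ) :
    3 * (thetaThree τ k a * thetaThree τ (k + 1) a * thetaThree τ (k - 1) a) *
        deriv (thetaThree τ k) a =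
      deriv (fun z => thetaThree τ k z * thetaThree τ (k + 1) z * thetaThree τ (k - 1) z) a *
        thetaThree τ k a -
      thetaThree τ 1 0 * thetaThree τ (-1) 0 * deriv (thetaThree τ 0) 0 *
        thetaThree τ (-(2 * k)) (-2 * a) := by
  have hz : thetaThree τ 0 0 = 0 :=
    (threeTerm_thetaThree_zero hτ).map_zero (exists_thetaThree_zero_ne_zero hτ)
  have hD : ∀ k z, HasDerivAt (thetaThree τ k) (deriv (thetaThree τ k) z) z :=
    fun k z => (differentiable_thetaThree hτ k z).hasDerivAt
  have h1 : HasDerivAt (fun b => thetaThree τ 1 0 * thetaThree τ (-1) 0 *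
      (thetaThree τ (2 * k) (a + b) * thetaThree τ 0 (a - b))) _ a :=
    (((hD (2 * k) (a + a)).comp_const_add a a).mul
      ((hD 0 (a - a)).comp_const_sub a a)).const_mul _
  have h2 := (((hD (k + 1) a).mul (hD (k - 1) a)).const_mul (thetaThree τ k a ^ 2)).sub
    (((hD k a).pow 2).const_mul (thetaThree τ (k + 1) a * thetaThree τ (k - 1) a))
  have h3 := h1.unique (h2.congr_of_eventuallyEq
    (Filter.Eventually.of_forall fun b => thetaThree_addition hτ k a b))
  have h4 : deriv (fun z => thetaThree τ k z * thetaThree τ (k + 1) z * thetaThree τ (k - 1) z) a =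
      _ := (((hD k a).mul (hD (k + 1) a)).mul (hD (k - 1) a)).deriv
  have h5 : thetaThree τ (-(2 * k)) (-2 * a) = -thetaThree τ (2 * k) (a + a) := by
    rw [← thetaThree_neg]
    ring_nf
  rw [h4, h5]
  simp only [sub_self, hz, Pi.mul_apply] at h3 ⊢
  push_cast at h3
  linear_combination h3

theorem hasDerivAt_thetaThree {τ : ℂ} (hτ : 0 < τ.im) {a : ℂ} (ha : ¬ IsThreeTorsion τ a) (k : ℤ)
    {c P P' : ℂ} (hc : c = -(thetaThree τ 1 0 * thetaThree τ (-1) 0 * deriv (thetaThree τ 0) 0) / 3)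
    (hc0 : c ≠ 0)
    (hP : thetaThree τ k a * thetaThree τ (k + 1) a * thetaThree τ (k - 1) a = P)
    (hP' : deriv (fun z => thetaThree τ k z * thetaThree τ (k + 1) z * thetaThree τ (k - 1) z) a =
      P') :
    HasDerivAt (thetaThree τ k)
      (c * (P' / (3 * P * c) * thetaThree τ k a + P⁻¹ * thetaThree τ k (-2 * a))) a := by
  have hP0 : P ≠ 0 := by
    rw [← hP]
    exact mul_ne_zero (mul_ne_zero (thetaThree_ne_zero hτ ha _) (thetaThree_ne_zero hτ ha _))
      (thetaThree_ne_zero hτ ha _)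
  have hper : thetaThree τ (-(2 * k)) (-2 * a) = thetaThree τ k (-2 * a) := by
    have hp : Function.Periodic (fun k : ℤ => thetaThree τ k (-2 * a)) 3 :=
      fun k => thetaThree_add_three τ k _
    have := hp.sub_zsmul_eq (x := k) k
    rw [show k - k • 3 = -(2 * k) by simp; ring] at this
    exact this
  have h := deriv_thetaThree hτ k a
  rw [hP, hP', hper] at h
  refine (differentiable_thetaThree hτ k a).hasDerivAt.congr_deriv ?_
  generalize thetaThree τ k (-2 * a) = y at h ⊢
  field_simp
  linear_combination h - 3 * y * hc

/-! ### Passage to the Moore matrix. -/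

theorem hasDerivAt_mooreMatrix {v : ℂ → Fin 3 → ℂ} {v' : Fin 3 → ℂ} {a : ℂ}
    (hv : ∀ j, HasDerivAt (fun b => v b j) (v' j) a) (x : Fin 3 → ℂ) :
    HasDerivAt (fun b => mooreMatrix (v b) x) (mooreMatrix v' x) a := by
  refine hasDerivAt_pi.2 fun i => hasDerivAt_pi.2 fun j => ?_
  fin_cases i <;> fin_cases j <;> exact (hv _).mul_const _

theorem mainTheorem9 (τ : ℂ) (hτ : 0 < τ.im) :
    ∃ c : ℂ, c ≠ 0 ∧ ∃ s : ℂ → ℂ, ∀ a : ℂ, ¬ IsThreeTorsion τ a →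
      hesseTheta τ 0 a * hesseTheta τ 1 a * hesseTheta τ 2 a ≠ 0 ∧
      ∀ x : Fin 3 → ℂ,
        HasDerivAt (fun b : ℂ => mooreMatrix (hesseVec τ b) x)
          (c • (s a • mooreMatrix (hesseVec τ a) x +
            mooreMatrix
              ((hesseTheta τ 0 a * hesseTheta τ 1 a * hesseTheta τ 2 a)⁻¹ •
                hesseVec τ (-2 * a)) x)) a := by
  have h0 : hesseTheta τ 0 = thetaThree τ 0 := funext fun z => hesseTheta_eq_thetaThree τ 0 z
  have h1 : hesseTheta τ 1 = thetaThree τ 1 := funext fun z => hesseTheta_eq_thetaThree τ 1 z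
  have h2 : hesseTheta τ 2 = thetaThree τ 2 := funext fun z => hesseTheta_eq_thetaThree τ 2 z
  set c : ℂ := -(thetaThree τ 1 0 * thetaThree τ (-1) 0 * deriv (thetaThree τ 0) 0) / 3 with hc
  have hc0 : c ≠ 0 := by
    have hd := (threeTerm_thetaThree_zero hτ).deriv_zero_ne_zero
      (differentiable_thetaThree_zero hτ) (exists_thetaThree_zero_ne_zero hτ)
    have hn := thetaThree_neg τ 1 0
    rw [neg_zero] at hn
    rw [hc, hn]
    simp [hd, thetaThree_one_zero_ne_zero hτ]
  refine ⟨c, hc0, fun a =>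
    deriv (fun z => thetaThree τ 0 z * thetaThree τ 1 z * thetaThree τ 2 z) a /
      (3 * (thetaThree τ 0 a * thetaThree τ 1 a * thetaThree τ 2 a) * c), fun a ha => ?_⟩
  rw [h0, h1, h2]
  refine ⟨mul_ne_zero (mul_ne_zero (thetaThree_ne_zero hτ ha _) (thetaThree_ne_zero hτ ha _))
      (thetaThree_ne_zero hτ ha _), fun x => ?_⟩
  have hm1 : ∀ z, thetaThree τ (-1) z = thetaThree τ 2 z := fun z =>
    (thetaThree_add_three τ (-1) z).symm
  have h3 : ∀ z, thetaThree τ 3 z = thetaThree τ 0 z := fun z =>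
    thetaThree_add_three τ 0 z
  -- The product over `j, j + 1, j - 1` runs through all residues mod 3, so one `s` serves all three
  -- coordinates.
  have hprod : ∀ (j : Fin 3) z, thetaThree τ ((j : ℕ) : ℤ) z *
      thetaThree τ (((j : ℕ) : ℤ) + 1) z * thetaThree τ (((j : ℕ) : ℤ) - 1) z =
      thetaThree τ 0 z * thetaThree τ 1 z * thetaThree τ 2 z := by
    intro j z
    fin_cases j
    · simp [hm1]
    · simp [mul_assoc, mul_comm]
    · norm_num [h3]
      ring
  have key := fun j : Fin 3 => show HasDerivAt (fun b => hesseVec τ b j) _ a from by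
    have := hasDerivAt_thetaThree hτ ha ((j : ℕ) : ℤ) hc hc0
      (P := thetaThree τ 0 a * thetaThree τ 1 a * thetaThree τ 2 a)
      (P' := deriv (fun z => thetaThree τ 0 z * thetaThree τ 1 z * thetaThree τ 2 z) a)
      (hprod j a) (by simp only [hprod])
    exact this.congr_of_eventuallyEq
      (Filter.Eventually.of_forall fun z => hesseTheta_eq_thetaThree τ j z)
  convert hasDerivAt_mooreMatrix key x using 1
  ext i j
  fin_cases i <;> fin_cases j <;>
    simp [mooreMatrix, hesseVec, h0, h1, h2] <;> ring
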